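/- Let $S$ be a finite non-commutative completely $0$-simple semigroup; that is, $S$ is a finite non-commutative semigroup with a zero $0$ such that not all products in $S$ are equal to $0$, the only (non-empty, two-sided) ideals of $S$ are $\{0\}$ and $S$, and $S$ contains a primitive idempotent (a non-zero idempotent $e$ such that the only non-zero idempotent $f$ with $ef=fe=f$ is $f=e$). Let $\mathcal{G}(S)$ be the commuting graph of $S$: the simple graph whose vertices are the non-central elements of $S$, two distinct vertices $x,y$ being adjacent if and only if $xy=yx$. If $\mathcal{G}(S)$ contains at least one cycle, then its girth (the length of a shortest cycle) is $3$ or $4$. -/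

import Mathlib

/-- A (two-sided) ideal of a semigroup `S`: a non-empty subset `I` with `S I ⊆ I` and `I S ⊆ I`. -/
structure IsTwoSidedSemigroupIdeal {S : Type*} [Semigroup S] (I : Set S) : Prop where
  nonempty : I.Nonempty
  mul_mem_left : ∀ s : S, ∀ x ∈ I, s * x ∈ I
  mul_mem_right : ∀ s : S, ∀ x ∈ I, x * s ∈ I

/-- A semigroup with zero is `0`-simple if it is not a null semigroup (some product is non-zero)
and its ideals are precisely `{0}` and `S`. -/
structure IsZeroSimple (S : Type*) [SemigroupWithZero S] : Prop where
  not_null : ∃ x y : S, x * y ≠ 0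
  ideal_iff : ∀ I : Set S, IsTwoSidedSemigroupIdeal I ↔ I = {0} ∨ I = Set.univ

/-- A primitive idempotent: a non-zero idempotent that is minimal among the non-zero idempotents
for the natural order `f ≤ e ↔ e * f = f ∧ f * e = f`. -/
structure IsPrimitiveIdempotent {S : Type*} [SemigroupWithZero S] (e : S) : Prop where
  idem : IsIdempotentElem e
  ne_zero : e ≠ 0
  minimal : ∀ f : S, IsIdempotentElem f → f ≠ 0 → e * f = f → f * e = f → f = e

/-- A completely `0`-simple semigroup: `0`-simple with a primitive idempotent. -/
structure IsCompletelyZeroSimple (S : Type*) [SemigroupWithZero S] : Prop where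
  zeroSimple : IsZeroSimple S
  exists_primitive : ∃ e : S, IsPrimitiveIdempotent e

/-- The commuting graph of a semigroup: its vertices are the non-central elements, and two
distinct vertices are adjacent when they commute. -/
def commutingGraph (S : Type*) [Semigroup S] : SimpleGraph {x : S // x ∉ Set.center S} where
  Adj x y := x ≠ y ∧ (x : S) * (y : S) = (y : S) * (x : S)
  symm := ⟨fun _ _ h => ⟨h.1.symm, h.2.symm⟩⟩
  loopless := ⟨fun _ h => h.1 rfl⟩

/-! In a finite `0`-simple semigroup a non-zero product `x * y` generates the right ideal of `x` and
the left ideal of `y`, and whether `x * y = 0` depends only on the left ideal of `x` and the right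
ideal of `y` (`mul_eq_zero_of_green`). So commuting elements are `H`-related or have zero products
both ways. If `H` is trivial off `0`, adjacency is read off the zero pattern of a sandwich matrix,
and `egirth_eq_three_or_four_of_coordinates` is pure combinatorics: without triangles or squares, at
most one row and one column hold two zeros, too few for a cycle. If `H` is nontrivial, an edge
between `H`-classes spreads to a square; otherwise a cycle stays in one `H`-class, null or closed
under non-zero products, and a triangle appears. -/

open SimpleGraph

/-! ### Graphs without triangles and squares -/

section Girth

variable {V : Type*} {G : SimpleGraph V}

theorem SimpleGraph.egirth_eq_three_or_four_of_triangle {a b c : V}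
    (hab : G.Adj a b) (hbc : G.Adj b c) (hca : G.Adj c a) :
    G.egirth = 3 ∨ G.egirth = 4 := by
  left
  refine le_antisymm ?_ G.three_le_egirth
  have hcyc : (Walk.cons hab (Walk.cons hbc (Walk.cons hca Walk.nil))).IsCycle := by
    have h1 := hab.ne
    have h2 := hbc.ne
    have h3 := hca.ne
    rw [Walk.cons_isCycle_iff]
    simp [Walk.cons_isPath_iff]
    grind
  simpa using egirth_le_length hcyc

theorem SimpleGraph.egirth_eq_three_or_four_of_square {a b c d : V}
    (hab : G.Adj a b) (hbc : G.Adj b c) (hcd : G.Adj c d) (hda : G.Adj d a)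
    (hac : a ≠ c) (hbd : b ≠ d) :
    G.egirth = 3 ∨ G.egirth = 4 := by
  have h3 := G.three_le_egirth
  have hcyc : (Walk.cons hab (Walk.cons hbc (Walk.cons hcd (Walk.cons hda Walk.nil)))).IsCycle := by
    have h1 := hab.ne
    have h2 := hbc.ne
    have h3 := hcd.ne
    have h4 := hda.ne
    rw [Walk.cons_isCycle_iff]
    simp [Walk.cons_isPath_iff]
    grind
  have h4 : G.egirth ≤ 4 := by simpa using egirth_le_length hcyc
  generalize G.egirth = n at h3 h4
  have hn : n ≠ ⊤ := fun h => by simp [h] at h4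
  lift n to ℕ using hn
  norm_cast at *
  omega

/-- A graph with a cycle has a nonempty vertex set inducing a subgraph of minimum degree at
least two. -/
theorem SimpleGraph.exists_set_two_neighbors_of_not_isAcyclic (h : ¬ G.IsAcyclic) :
    ∃ C : Set V, C.Nonempty ∧
      ∀ v ∈ C, ∃ a ∈ C, ∃ b ∈ C, a ≠ b ∧ G.Adj v a ∧ G.Adj v b := by
  simp only [IsAcyclic, not_forall, not_not] at h
  obtain ⟨u, p, hp⟩ := h
  refine ⟨{v | v ∈ p.support}, ⟨u, p.start_mem_support⟩, fun v hv => ?_⟩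
  have h2 := hp.ncard_neighborSet_toSubgraph_eq_two hv
  obtain ⟨a, b, hab, hs⟩ := Set.ncard_eq_two.mp h2
  have ha : p.toSubgraph.Adj v a := by
    have : a ∈ p.toSubgraph.neighborSet v := by rw [hs]; simp
    exact this
  have hb : p.toSubgraph.Adj v b := by
    have : b ∈ p.toSubgraph.neighborSet v := by rw [hs]; simp
    exact this
  exact ⟨a, by simpa using ha.snd_mem, b, by simpa using hb.snd_mem, hab, ha.adj_sub, hb.adj_sub⟩

/-- The commuting graph of an aperiodic Rees matrix semigroup, described by the zero pattern `Z`
of its sandwich matrix: a graph with coordinates `r`, `l` in which distinct `x`, `y` are adjacent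
iff `Z (l x) (r y)` and `Z (l y) (r x)`. -/
theorem SimpleGraph.egirth_eq_three_or_four_of_coordinates {I Λ : Type*}
    (r : V → I) (l : V → Λ) (m : I → Λ → V) (hr : ∀ i j, r (m i j) = i)
    (hl : ∀ i j, l (m i j) = j) (hext : ∀ x y, r x = r y → l x = l y → x = y)
    (Z : Λ → I → Prop)
    (hadj : ∀ x y, G.Adj x y ↔ x ≠ y ∧ Z (l x) (r y) ∧ Z (l y) (r x))
    (h : ¬ G.IsAcyclic) : G.egirth = 3 ∨ G.egirth = 4 := by
  by_contra hcon
  have tri : ∀ a b c, G.Adj a b → G.Adj b c → G.Adj c a → False := fun a b c h1 h2 h3 =>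
    hcon (egirth_eq_three_or_four_of_triangle h1 h2 h3)
  have sq : ∀ a b c d, G.Adj a b → G.Adj b c → G.Adj c d → G.Adj d a → a ≠ c → b ≠ d → False :=
    fun a b c d h1 h2 h3 h4 h5 h6 =>
      hcon (egirth_eq_three_or_four_of_square h1 h2 h3 h4 h5 h6)
  have mne : ∀ i j i' j', (i ≠ i' ∨ j ≠ j') → m i j ≠ m i' j' := by
    intro i j i' j' hne heq
    have h1 := congrArg r heq
    have h2 := congrArg l heq
    simp only [hr, hl] at h1 h2
    tauto
  have madj : ∀ i j i' j', (i ≠ i' ∨ j ≠ j') → Z j i' → Z j' i → G.Adj (m i j) (m i' j') := by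
    intro i j i' j' hne h1 h2
    rw [hadj]
    simp only [hr, hl]
    exact ⟨mne _ _ _ _ hne, h1, h2⟩
  have col3 : ∀ i a b c, Z a i → Z b i → Z c i → a ≠ b → b ≠ c → c ≠ a → False :=
    fun i a b c ha hb hc h1 h2 h3 => tri (m i a) (m i b) (m i c)
      (madj _ _ _ _ (.inr h1) ha hb) (madj _ _ _ _ (.inr h2) hb hc) (madj _ _ _ _ (.inr h3) hc ha)
  have row3 : ∀ j a b c, Z j a → Z j b → Z j c → a ≠ b → b ≠ c → c ≠ a → False :=
    fun j a b c ha hb hc h1 h2 h3 => tri (m a j) (m b j) (m c j)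
      (madj _ _ _ _ (.inl h1) hb ha) (madj _ _ _ _ (.inl h2) hc hb) (madj _ _ _ _ (.inl h3) ha hc)
  -- Two columns with two zeros each give a complete bipartite graph on 2 + 2 vertices.
  have col2 : ∀ i j a b c d, a ≠ b → c ≠ d → Z a i → Z b i → Z c j → Z d j → i = j := by
    intro i j a b c d hab hcd ha hb hc hd
    by_contra hij
    exact sq (m j a) (m i c) (m j b) (m i d) (madj _ _ _ _ (.inl (Ne.symm hij)) ha hc)
      (madj _ _ _ _ (.inl hij) hc hb) (madj _ _ _ _ (.inl (Ne.symm hij)) hb hd)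
      (madj _ _ _ _ (.inl hij) hd ha) (mne _ _ _ _ (.inr hab)) (mne _ _ _ _ (.inr hcd))
  have row2 : ∀ i j a b c d, a ≠ b → c ≠ d → Z i a → Z i b → Z j c → Z j d → i = j := by
    intro i j a b c d hab hcd ha hb hc hd
    by_contra hij
    exact sq (m a j) (m c i) (m b j) (m d i) (madj _ _ _ _ (.inr (Ne.symm hij)) hc ha)
      (madj _ _ _ _ (.inr hij) hb hc) (madj _ _ _ _ (.inr (Ne.symm hij)) hd hb)
      (madj _ _ _ _ (.inr hij) ha hd) (mne _ _ _ _ (.inl hab)) (mne _ _ _ _ (.inl hcd))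
  obtain ⟨C, ⟨v₀, hv₀⟩, hC⟩ := exists_set_two_neighbors_of_not_isAcyclic h
  let bigCol : I → Prop := fun i => ∃ a b, a ≠ b ∧ Z a i ∧ Z b i
  let bigRow : Λ → Prop := fun j => ∃ a b, a ≠ b ∧ Z j a ∧ Z j b
  have colU : ∀ i j, bigCol i → bigCol j → i = j := by
    rintro i j ⟨a, b, hab, ha, hb⟩ ⟨c, d, hcd, hc, hd⟩
    exact col2 i j a b c d hab hcd ha hb hc hd
  have rowU : ∀ i j, bigRow i → bigRow j → i = j := by
    rintro i j ⟨a, b, hab, ha, hb⟩ ⟨c, d, hcd, hc, hd⟩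
    exact row2 i j a b c d hab hcd ha hb hc hd
  -- Two distinct neighbours of `v` differ in a coordinate, giving two zeros in the row or the
  -- column of `v`.
  have cross : ∀ v ∈ C, bigCol (r v) ∨ bigRow (l v) := by
    intro v hv
    obtain ⟨a, -, b, -, hab, hva, hvb⟩ := hC v hv
    rw [hadj] at hva hvb
    by_cases hlab : l a = l b
    · exact .inr ⟨r a, r b, fun h => hab (hext _ _ h hlab), hva.2.1, hvb.2.1⟩
    · exact .inl ⟨l a, l b, hlab, hva.2.2, hvb.2.2⟩
  have hrow : ∀ v ∈ C, bigRow (l v) := by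
    intro v hv
    by_contra hn
    obtain ⟨a, ha, b, hb, hab, hva, hvb⟩ := hC v hv
    have hcv := (cross v hv).resolve_right hn
    rw [hadj] at hva hvb
    have hrab : r a = r b := by
      by_contra hne
      exact hn ⟨r a, r b, hne, hva.2.1, hvb.2.1⟩
    have hlab : l a ≠ l b := fun h => hab (hext _ _ hrab h)
    -- Otherwise `l a` and `l b` would be two different big rows.
    have hca : bigCol (r a) := by
      rcases cross a ha with h | h
      · exact h
      rcases cross b hb with h' | h'
      · rwa [hrab]
      · exact absurd (rowU _ _ h h') hlab
    have hrva := colU _ _ hcv hca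
    refine col3 (r v) (l v) (l a) (l b) ?_ hva.2.2 hvb.2.2 ?_ hlab ?_
    · rw [hrva]; exact hva.2.1
    · exact fun h => hva.1 (hext _ _ hrva h)
    · exact fun h => hvb.1 (hext _ _ (hrva.trans hrab) h.symm)
  have hcol : ∀ v ∈ C, bigCol (r v) := by
    intro v hv
    by_contra hn
    obtain ⟨a, ha, b, hb, hab, hva, hvb⟩ := hC v hv
    rw [hadj] at hva hvb
    have hlab : l a = l b := rowU _ _ (hrow a ha) (hrow b hb)
    have hlva : l v = l a := rowU _ _ (hrow v hv) (hrow a ha)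
    have hrab : r a ≠ r b := fun h => hab (hext _ _ h hlab)
    refine row3 (l v) (r v) (r a) (r b) ?_ hva.2.1 hvb.2.1 ?_ hrab ?_
    · have := hva.2.2; rwa [← hlva] at this
    · exact fun h => hva.1 (hext _ _ h hlva)
    · exact fun h => hvb.1 (hext _ _ h.symm (hlva.trans hlab))
  -- Both coordinates are now constant on `C`, so `C` is a single vertex.
  obtain ⟨a, ha, -, -, -, hva, -⟩ := hC v₀ hv₀
  exact hva.ne (hext _ _ (colU _ _ (hcol _ hv₀) (hcol _ ha)) (rowU _ _ (hrow _ hv₀) (hrow _ ha)))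

end Girth

/-! ### Green's relations in finite `0`-simple semigroups -/

section ZeroSimple

variable {S : Type*} [SemigroupWithZero S]

/-- The principal right ideal `xS`. -/
def rightMultiples (x : S) : Set S := Set.range (x * ·)

/-- The principal left ideal `Sx`. -/
def leftMultiples (x : S) : Set S := Set.range (· * x)

/-- Green's relation `H`, for elements lying in `xS` and `Sx`. -/
def GreenH (x y : S) : Prop :=
  rightMultiples x = rightMultiples y ∧ leftMultiples x = leftMultiples y

theorem GreenH.symm {x y : S} (h : GreenH x y) : GreenH y x := ⟨h.1.symm, h.2.symm⟩

theorem GreenH.trans {x y z : S} (h : GreenH x y) (h' : GreenH y z) : GreenH x z :=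
  ⟨h.1.trans h'.1, h.2.trans h'.2⟩

theorem rightMultiples_mul_subset (x c : S) : rightMultiples (x * c) ⊆ rightMultiples x := by
  rintro _ ⟨s, rfl⟩
  exact ⟨c * s, by simp only [mul_assoc]⟩

theorem leftMultiples_mul_subset (a x : S) : leftMultiples (a * x) ⊆ leftMultiples x := by
  rintro _ ⟨s, rfl⟩
  exact ⟨s * a, by simp only [mul_assoc]⟩

theorem rightMultiples_eq_image {x a c : S} (h : a * x * c = x) :
    rightMultiples x = (a * ·) '' rightMultiples (x * c) := by
  ext y
  constructor
  · rintro ⟨s, rfl⟩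
    exact ⟨x * c * s, ⟨s, rfl⟩, by simp only [← mul_assoc, h]⟩
  · rintro ⟨_, ⟨s, rfl⟩, rfl⟩
    exact ⟨s, by simp only [← mul_assoc, h]⟩

theorem leftMultiples_eq_image {x a c : S} (h : a * x * c = x) :
    leftMultiples x = (· * c) '' leftMultiples (a * x) := by
  ext y
  constructor
  · rintro ⟨s, rfl⟩
    exact ⟨s * (a * x), ⟨s, rfl⟩, by simp only [mul_assoc] at h ⊢; rw [h]⟩
  · rintro ⟨_, ⟨s, rfl⟩, rfl⟩
    exact ⟨s, by simp only [mul_assoc] at h ⊢; rw [h]⟩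

/-- Left multiplication by `a` maps `xcS` onto `xS`, so by finiteness the subset `xcS` cannot be
smaller. -/
theorem rightMultiples_eq_of_mul_mul_eq [Finite S] {x a c : S} (h : a * x * c = x) :
    rightMultiples (x * c) = rightMultiples x := by
  refine Set.eq_of_subset_of_ncard_le (rightMultiples_mul_subset x c) ?_ (Set.toFinite _)
  rw [rightMultiples_eq_image h]
  exact Set.ncard_image_le (Set.toFinite _)

theorem leftMultiples_eq_of_mul_mul_eq [Finite S] {x a c : S} (h : a * x * c = x) :
    leftMultiples (a * x) = leftMultiples x := by
  refine Set.eq_of_subset_of_ncard_le (leftMultiples_mul_subset a x) ?_ (Set.toFinite _)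
  rw [leftMultiples_eq_image h]
  exact Set.ncard_image_le (Set.toFinite _)

theorem ne_zero_of_rightMultiples_eq {x y : S} (hx : x ∈ rightMultiples x) (hx0 : x ≠ 0)
    (h : rightMultiples x = rightMultiples y) : y ≠ 0 := by
  rintro rfl
  rw [h] at hx
  obtain ⟨s, hs⟩ := hx
  exact hx0 (by simpa using hs.symm)

theorem ne_zero_of_notMem_center {x : S} (hx : x ∉ Set.center S) : x ≠ 0 := by
  rintro rfl
  exact hx (Set.zero_mem_center)

namespace IsZeroSimple

/-- `SaS` is an ideal. If it were `{0}`, `a` would lie in the ideal of all `b` with `SbS = 0`; this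
is not `S`, because `S² = S` would then make every product vanish. -/
theorem exists_mul_mul_eq (hS : IsZeroSimple S) {a : S} (ha : a ≠ 0) (s : S) : ∃ u v, u * a * v = s := by
  have hN : ∀ b : S, (∀ u v, u * b * v = 0) → b = 0 := by
    have h1 : IsTwoSidedSemigroupIdeal {b : S | ∀ u v, u * b * v = 0} :=
      ⟨⟨0, by simp⟩, fun s x hx u v => by rw [← mul_assoc]; exact hx _ _,
        fun s x hx u v => by rw [← mul_assoc, mul_assoc]; exact hx _ _⟩
    rcases (hS.ideal_iff _).mp h1 with h | h
    · intro b hb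
      have : b ∈ ({0} : Set S) := h ▸ hb
      exact this
    · exfalso
      have h2 : IsTwoSidedSemigroupIdeal {b : S | ∃ u v, b = u * v} := by
        obtain ⟨x, y, -⟩ := hS.not_null
        refine ⟨⟨x * y, x, y, rfl⟩, ?_, ?_⟩
        · rintro s _ ⟨u, v, rfl⟩; exact ⟨s, u * v, rfl⟩
        · rintro s _ ⟨u, v, rfl⟩; exact ⟨u * v, s, rfl⟩
      obtain ⟨x, y, hxy⟩ := hS.not_null
      rcases (hS.ideal_iff _).mp h2 with h' | h'
      · have : x * y ∈ ({0} : Set S) := h' ▸ ⟨x, y, rfl⟩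
        exact hxy this
      · have hx : x ∈ {b : S | ∃ u v, b = u * v} := h' ▸ Set.mem_univ x
        obtain ⟨u, v, rfl⟩ := hx
        have hv : v ∈ {b : S | ∀ u v, u * b * v = 0} := h ▸ Set.mem_univ v
        exact hxy (hv u y)
  have h1 : IsTwoSidedSemigroupIdeal {s : S | ∃ u v, u * a * v = s} := by
    refine ⟨⟨a * a * a, a, a, rfl⟩, ?_, ?_⟩
    · rintro s _ ⟨u, v, rfl⟩; exact ⟨s * u, v, by simp only [mul_assoc]⟩
    · rintro s _ ⟨u, v, rfl⟩; exact ⟨u, v * s, by simp only [mul_assoc]⟩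
  rcases (hS.ideal_iff _).mp h1 with h | h
  · refine absurd (hN a fun u v => ?_) ha
    have : u * a * v ∈ ({0} : Set S) := h ▸ ⟨u, v, rfl⟩
    exact this
  · have : s ∈ {s : S | ∃ u v, u * a * v = s} := h ▸ Set.mem_univ s
    exact this


variable [Finite S] (hS : IsZeroSimple S)
include hS

theorem mem_rightMultiples_self {x : S} (hx : x ≠ 0) : x ∈ rightMultiples x := by
  obtain ⟨u, v, h⟩ := hS.exists_mul_mul_eq hx x
  have h1 := rightMultiples_eq_image h
  rw [rightMultiples_eq_of_mul_mul_eq h] at h1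
  rw [h1]
  exact ⟨x * v, ⟨v, rfl⟩, by simp only [← mul_assoc, h]⟩

theorem mem_leftMultiples_self {x : S} (hx : x ≠ 0) : x ∈ leftMultiples x := by
  obtain ⟨u, v, h⟩ := hS.exists_mul_mul_eq hx x
  have h1 := leftMultiples_eq_image h
  rw [leftMultiples_eq_of_mul_mul_eq h] at h1
  rw [h1]
  exact ⟨u * x, ⟨u, rfl⟩, h⟩

theorem rightMultiples_mul {x y : S} (h : x * y ≠ 0) :
    rightMultiples (x * y) = rightMultiples x := by
  obtain ⟨u, v, huv⟩ := hS.exists_mul_mul_eq h x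
  refine (rightMultiples_mul_subset x y).antisymm ?_
  rw [← rightMultiples_eq_of_mul_mul_eq (x := x) (a := u) (c := y * v)
    (by simpa only [mul_assoc] using huv), ← mul_assoc]
  exact rightMultiples_mul_subset _ _

theorem leftMultiples_mul {x y : S} (h : x * y ≠ 0) :
    leftMultiples (x * y) = leftMultiples y := by
  obtain ⟨u, v, huv⟩ := hS.exists_mul_mul_eq h y
  refine (leftMultiples_mul_subset x y).antisymm ?_
  rw [← leftMultiples_eq_of_mul_mul_eq (x := y) (a := u * x) (c := v)
    (by simpa only [mul_assoc] using huv), mul_assoc]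
  exact leftMultiples_mul_subset _ _

theorem exists_eq_mul_right {x y : S} (hy : y ≠ 0) (h : rightMultiples x = rightMultiples y) :
    ∃ s, x * s = y := by
  have := hS.mem_rightMultiples_self hy
  rwa [← h] at this

theorem exists_eq_mul_left {x y : S} (hy : y ≠ 0) (h : leftMultiples x = leftMultiples y) :
    ∃ s, s * x = y := by
  have := hS.mem_leftMultiples_self hy
  rwa [← h] at this

theorem exists_mul_mul_ne_zero {x y : S} (hx : x ≠ 0) (hy : y ≠ 0) : ∃ s, x * s * y ≠ 0 := by
  obtain ⟨w, hw⟩ := hS.mem_rightMultiples_self hx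
  obtain ⟨u, v, rfl⟩ := hS.exists_mul_mul_eq hy w
  refine ⟨u, fun h => hx ?_⟩
  rw [← hw]
  simp only [← mul_assoc, h, zero_mul]

theorem greenH_ne_zero {x y : S} (hx : x ≠ 0) (h : GreenH x y) : y ≠ 0 :=
  ne_zero_of_rightMultiples_eq (hS.mem_rightMultiples_self hx) hx h.1

theorem exists_green_between {x y : S} (hx : x ≠ 0) (hy : y ≠ 0) :
    ∃ z, z ≠ 0 ∧ rightMultiples z = rightMultiples x ∧ leftMultiples z = leftMultiples y := by
  obtain ⟨s, hs⟩ := hS.exists_mul_mul_ne_zero hx hy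
  exact ⟨x * s * y, hs, by rw [mul_assoc] at hs ⊢; exact hS.rightMultiples_mul hs,
    hS.leftMultiples_mul hs⟩

theorem mul_eq_zero_of_green {x y x' y' : S} (hx' : x' ≠ 0) (hy' : y' ≠ 0)
    (hl : leftMultiples x = leftMultiples x') (hr : rightMultiples y = rightMultiples y')
    (h : x * y = 0) : x' * y' = 0 := by
  obtain ⟨s, rfl⟩ := hS.exists_eq_mul_left hx' hl
  obtain ⟨t, rfl⟩ := hS.exists_eq_mul_right hy' hr
  rw [mul_assoc, ← mul_assoc x, h]
  simp

theorem greenH_of_commute {x y : S} (hxy : x * y = y * x) (h : x * y ≠ 0) : GreenH x y :=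
  ⟨(hS.rightMultiples_mul h).symm.trans (by rw [hxy] at h ⊢; exact hS.rightMultiples_mul h),
    Eq.trans (by rw [hxy] at h ⊢; exact (hS.leftMultiples_mul h).symm) (hS.leftMultiples_mul h)⟩

/-- For `x * s * z ≠ 0`, centrality lets the product start with either `x` or `z`; dually on the
left. -/
theorem greenH_of_mem_center {z x : S} (hz : z ∈ Set.center S) (hz0 : z ≠ 0) (hx : x ≠ 0) :
    GreenH x z := by
  have hc := Semigroup.mem_center_iff.mp hz
  constructor
  · obtain ⟨s, hs⟩ := hS.exists_mul_mul_ne_zero hx hz0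
    have h1 := hS.rightMultiples_mul (by rwa [mul_assoc] at hs)
    rw [← mul_assoc, hc] at h1
    rw [← h1]
    exact hS.rightMultiples_mul (by rwa [hc] at hs)
  · obtain ⟨s, hs⟩ := hS.exists_mul_mul_ne_zero hz0 hx
    have h1 := hS.leftMultiples_mul hs
    rw [mul_assoc, ← hc] at h1
    rw [← h1]
    exact hS.leftMultiples_mul (by rwa [mul_assoc, ← hc] at hs)

/-- A non-zero central element would leave a single non-zero `H`-class, where one zero product kills
all products. -/
theorem notMem_center_of_mul_eq_zero {x y z : S} (hx : x ≠ 0) (hy : y ≠ 0) (hxy : x * y = 0)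
    (hz : z ≠ 0) : z ∉ Set.center S := by
  intro hc
  obtain ⟨p, q, hpq⟩ := hS.not_null
  have hp : p ≠ 0 := fun h => hpq (by simp [h])
  have hq : q ≠ 0 := fun h => hpq (by simp [h])
  exact hpq (hS.mul_eq_zero_of_green hp hq
    ((hS.greenH_of_mem_center hc hz hx).2.trans (hS.greenH_of_mem_center hc hz hp).2.symm)
    ((hS.greenH_of_mem_center hc hz hy).1.trans (hS.greenH_of_mem_center hc hz hq).1.symm) hxy)

/-- All `H`-classes of non-zero elements are nontrivial as soon as one is. -/
theorem exists_greenH_ne {x y : S} (hx : x ≠ 0) (hxy : x ≠ y) (h : GreenH x y) {u : S}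
    (hu : u ≠ 0) : ∃ v, v ≠ u ∧ GreenH u v := by
  have hy := hS.greenH_ne_zero hx h
  obtain ⟨s, hs⟩ := hS.exists_mul_mul_ne_zero hu hx
  obtain ⟨t, ht⟩ := hS.exists_mul_mul_ne_zero hs hu
  -- The map `z ↦ u * s * z * t * u` sends the class of `x` into that of `u`; it separates `x` from
  -- `y`, so one of the two images differs from `u`.
  have key : ∀ z, GreenH x z → GreenH u (u * s * z * t * u) := by
    intro z hz
    have hz0 := hS.greenH_ne_zero hx hz
    have h1 : u * s * z ≠ 0 := fun h0 => hs (hS.mul_eq_zero_of_green (x := u * s) (y := z)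
      (fun h => hs (by rw [h, zero_mul])) hx rfl hz.1.symm h0)
    have h2 : u * s * z * t * u ≠ 0 := by
      intro h0
      rw [mul_assoc] at h0
      refine ht ?_
      rw [mul_assoc]
      refine hS.mul_eq_zero_of_green (x := u * s * z) (y := t * u) hs
        (fun h => ht (by rw [mul_assoc, h, mul_zero])) ?_ rfl h0
      rw [hS.leftMultiples_mul h1, hS.leftMultiples_mul hs, hz.2]
    refine ⟨?_, (hS.leftMultiples_mul h2).symm⟩
    have h3 : u * (s * z * t * u) ≠ 0 := by simpa only [mul_assoc] using h2
    have := hS.rightMultiples_mul h3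
    simp only [← mul_assoc] at this
    exact this.symm
  have inj : u * s * x * t * u ≠ u * s * y * t * u := by
    intro heq
    obtain ⟨a, ha⟩ := hS.exists_eq_mul_left hx (hS.leftMultiples_mul hs)
    have hr : x * (t * u) ≠ 0 := fun h0 => ht (by
      rw [mul_assoc, mul_assoc, h0, mul_zero])
    obtain ⟨b, hb⟩ := hS.exists_eq_mul_right hx (hS.rightMultiples_mul hr)
    obtain ⟨p, hp⟩ := hS.exists_eq_mul_right hy h.1
    obtain ⟨q, hq⟩ := hS.exists_eq_mul_left hy h.2
    have ha' : a * (u * s * y) = y := by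
      rw [← hp, ← mul_assoc (u * s), ← mul_assoc, ha]
    have hb' : y * (t * u) * b = y := by
      rw [← hq, mul_assoc q, mul_assoc q, hb]
    apply hxy
    calc x = a * (u * s * x) * (t * u) * b := by rw [ha, hb]
      _ = a * (u * s * x * t * u) * b := by simp only [mul_assoc]
      _ = a * (u * s * y * t * u) * b := by rw [heq]
      _ = a * (u * s * y) * (t * u) * b := by simp only [mul_assoc]
      _ = y := by rw [ha', hb']
  by_cases h1 : u * s * x * t * u = u
  · exact ⟨_, fun h2 => inj (h1.trans h2.symm), key y h⟩
  · exact ⟨_, h1, key x ⟨rfl, rfl⟩⟩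

/-- Some `t` satisfies `t * x * y = y`, so `t * x` fixes every element of `yS`. -/
theorem mul_left_cancel_of_greenH {x y a b : S} (hxy : x * y ≠ 0) (ha : GreenH y a)
    (hb : GreenH y b) (h : x * a = x * b) : a = b := by
  have hy : y ≠ 0 := fun h => hxy (by rw [h, mul_zero])
  obtain ⟨t, ht⟩ := hS.exists_eq_mul_left hy (hS.leftMultiples_mul hxy)
  obtain ⟨p, hp⟩ := hS.exists_eq_mul_right (hS.greenH_ne_zero hy ha) ha.1
  obtain ⟨q, hq⟩ := hS.exists_eq_mul_right (hS.greenH_ne_zero hy hb) hb.1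
  calc a = t * (x * a) := by rw [← hp, ← mul_assoc x, ← mul_assoc, ht]
    _ = t * (x * b) := by rw [h]
    _ = b := by rw [← hq, ← mul_assoc x, ← mul_assoc, ht]

/-- Fixing `z` makes `y` a left identity on its class; thus `y` is idempotent and also a right
identity. -/
theorem commute_of_mul_eq_self {y z w : S} (hz : z ≠ 0) (hyz : y * z = z) (hy : GreenH y z)
    (hw : GreenH y w) : w * y = y * w := by
  have hy0 := hS.greenH_ne_zero hz hy.symm
  have hw0 := hS.greenH_ne_zero hy0 hw
  have hleft : ∀ v, v ≠ 0 → GreenH y v → y * v = v := by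
    intro v hv0 hv
    obtain ⟨p, rfl⟩ := hS.exists_eq_mul_right hv0 (hy.1.symm.trans hv.1)
    rw [← mul_assoc, hyz]
  have hyy := hleft y hy0 ⟨rfl, rfl⟩
  obtain ⟨q, rfl⟩ := hS.exists_eq_mul_left hw0 hw.2
  rw [hleft _ hw0 hw, mul_assoc, hyy]

/-- Zero-product edges between different `H`-classes lie on squares when `H` is nontrivial. -/
theorem egirth_of_mul_eq_zero {x₀ y₀ : S} (hx₀ : x₀ ≠ 0) (hne : x₀ ≠ y₀) (h₀ : GreenH x₀ y₀)
    {x y : S} (hx : x ≠ 0) (hy : y ≠ 0) (hxy : x * y = 0) (hyx : y * x = 0) (hH : ¬ GreenH x y) :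
    (commutingGraph S).egirth = 3 ∨ (commutingGraph S).egirth = 4 := by
  obtain ⟨x', hx', hxx⟩ := hS.exists_greenH_ne hx₀ hne h₀ hx
  obtain ⟨y', hy', hyy⟩ := hS.exists_greenH_ne hx₀ hne h₀ hy
  have hx0' := hS.greenH_ne_zero hx hxx
  have hy0' := hS.greenH_ne_zero hy hyy
  have hnc : ∀ {z : S}, z ≠ 0 → z ∉ Set.center S := hS.notMem_center_of_mul_eq_zero hx hy hxy
  have adj : ∀ a b (ha : a ≠ 0) (hb : b ≠ 0), GreenH x a → GreenH y b →
      (commutingGraph S).Adj ⟨a, hnc ha⟩ ⟨b, hnc hb⟩ := by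
    intro a b ha hb hxa hyb
    refine ⟨fun h => hH (hxa.trans ?_), ?_⟩
    · rw [show a = b from congrArg Subtype.val h]; exact hyb.symm
    · change a * b = b * a
      rw [hS.mul_eq_zero_of_green ha hb hxa.2 hyb.1 hxy,
        hS.mul_eq_zero_of_green hb ha hyb.2 hxa.1 hyx]
  exact egirth_eq_three_or_four_of_square (adj x y hx hy ⟨rfl, rfl⟩ ⟨rfl, rfl⟩)
    (adj x' y hx0' hy hxx ⟨rfl, rfl⟩).symm (adj x' y' hx0' hy0' hxx hyy)
    (adj x y' hx hy0' ⟨rfl, rfl⟩ hyy).symm (fun h => hx' (congrArg Subtype.val h).symm)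
    (fun h => hy' (congrArg Subtype.val h).symm)

/-- A path with three edges inside one `H`-class forces a triangle. -/
theorem egirth_of_greenH_path {w x y z : {s : S // s ∉ Set.center S}}
    (hwx : (commutingGraph S).Adj w x) (hxy : (commutingGraph S).Adj x y)
    (hyz : (commutingGraph S).Adj y z) (hwy : w ≠ y) (hxz : x ≠ z)
    (Hw : GreenH (y : S) w) (Hx : GreenH (y : S) x) (Hz : GreenH (y : S) z) :
    (commutingGraph S).egirth = 3 ∨ (commutingGraph S).egirth = 4 := by
  have hx0 := ne_zero_of_notMem_center x.2
  have hy0 := ne_zero_of_notMem_center y.2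
  have hz0 := ne_zero_of_notMem_center z.2
  by_cases h0 : (y : S) * z = 0
  · have hz : ∀ {a b : S}, a ≠ 0 → b ≠ 0 → GreenH (y : S) a → GreenH (y : S) b → a * b = 0 :=
      fun ha hb hya hyb => hS.mul_eq_zero_of_green ha hb hya.2 (Hz.1.symm.trans hyb.1) h0
    exact egirth_eq_three_or_four_of_triangle hxy hyz
      ⟨hxz.symm, by rw [hz hz0 hx0 Hz Hx, hz hx0 hz0 Hx Hz]⟩
  have hne : ∀ {a b : S}, a ≠ 0 → b ≠ 0 → GreenH (y : S) a → GreenH (y : S) b → a * b ≠ 0 :=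
    fun ha hb hya hyb h => h0 (hS.mul_eq_zero_of_green hy0 hz0 hya.2.symm
      (hyb.1.symm.trans Hz.1) h)
  have hcyz : (y : S) * z = z * y := hyz.2
  have hmul : ∀ {a b : S}, a ≠ 0 → b ≠ 0 → GreenH (y : S) a → GreenH (y : S) b →
      GreenH (y : S) (a * b) := fun ha hb hya hyb =>
    ⟨hya.1.trans (hS.rightMultiples_mul (hne ha hb hya hyb)).symm,
      hyb.2.trans (hS.leftMultiples_mul (hne ha hb hya hyb)).symm⟩
  -- The triangle is `y`, `z`, `y * z`, unless `y * z` is `z`, `y` or central. In the first two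
  -- cases `y` or `z` is an identity of the class; in the last, cancelling `y` shows that `x` and
  -- `z` commute.
  by_cases h1 : (y : S) * z = z
  · exact egirth_eq_three_or_four_of_triangle hwx hxy
      ⟨hwy.symm, (hS.commute_of_mul_eq_self hz0 h1 Hz Hw).symm⟩
  by_cases h2 : (y : S) * z = y
  · exact egirth_eq_three_or_four_of_triangle hxy hyz
      ⟨hxz.symm, (hS.commute_of_mul_eq_self hy0 (hcyz.symm.trans h2) Hz.symm
        (Hz.symm.trans Hx)).symm⟩
  by_cases hc : (y : S) * z ∈ Set.center S
  · refine egirth_eq_three_or_four_of_triangle hxy hyz ⟨hxz.symm, ?_⟩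
    have hcx : (x : S) * y = y * x := hxy.2
    refine hS.mul_left_cancel_of_greenH (x := (y : S)) (y := (z : S)) h0
      (Hz.symm.trans (hmul hz0 hx0 Hz Hx)) (Hz.symm.trans (hmul hx0 hz0 Hx Hz)) ?_
    rw [← mul_assoc, ← mul_assoc, ← hcx, mul_assoc (x : S)]
    exact (Semigroup.mem_center_iff.mp hc x).symm
  · refine egirth_eq_three_or_four_of_triangle (c := ⟨(y : S) * z, hc⟩) hyz
      ⟨fun h => h1 (congrArg Subtype.val h).symm, ?_⟩ ⟨fun h => h2 (congrArg Subtype.val h), ?_⟩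
    · change (z : S) * (y * z) = y * z * z
      rw [← mul_assoc, hcyz]
    · change (y : S) * z * y = y * (y * z)
      rw [mul_assoc, ← hcyz]

/-! ### The two cases: trivial and nontrivial `H` -/

theorem egirth_of_greenH_trivial (hnc : ∃ x y : S, x * y ≠ y * x)
    (htriv : ∀ x y : S, x ≠ 0 → GreenH x y → x = y) (hcycle : ¬ (commutingGraph S).IsAcyclic) :
    (commutingGraph S).egirth = 3 ∨ (commutingGraph S).egirth = 4 := by
  -- A non-zero central `z` would force `S = {0, z}`, which is commutative.
  have hcen : ∀ z : S, z ≠ 0 → z ∉ Set.center S := by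
    intro z hz hzc
    have hall : ∀ x : S, x ≠ 0 → x = z := fun x hx =>
      htriv x z hx (hS.greenH_of_mem_center hzc hz hx)
    obtain ⟨x, y, hxy⟩ := hnc
    have hx : x ≠ 0 := by rintro rfl; simp at hxy
    have hy : y ≠ 0 := by rintro rfl; simp at hxy
    exact hxy (by rw [hall x hx, hall y hy])
  have hnz : ∀ v : {s : S // s ∉ Set.center S}, (v : S) ≠ 0 := fun v =>
    ne_zero_of_notMem_center v.2
  have hm : ∀ (i : Set.range fun v : {s : S // s ∉ Set.center S} => rightMultiples (v : S))
      (j : Set.range fun v : {s : S // s ∉ Set.center S} => leftMultiples (v : S)),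
      ∃ v : {s : S // s ∉ Set.center S}, rightMultiples (v : S) = i ∧ leftMultiples (v : S) = j := by
    rintro ⟨_, x, rfl⟩ ⟨_, y, rfl⟩
    obtain ⟨z, hz, h1, h2⟩ := hS.exists_green_between (hnz x) (hnz y)
    exact ⟨⟨z, hcen z hz⟩, h1, h2⟩
  choose m hmr hml using hm
  refine egirth_eq_three_or_four_of_coordinates (fun v => ⟨rightMultiples (v : S), v, rfl⟩)
    (fun v => ⟨leftMultiples (v : S), v, rfl⟩) m (fun i j => Subtype.ext (hmr i j))
    (fun i j => Subtype.ext (hml i j)) ?_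
    (fun j i => ∀ a b : S, a ≠ 0 → b ≠ 0 → leftMultiples a = j → rightMultiples b = i → a * b = 0)
    ?_ hcycle
  · intro x y h1 h2
    exact Subtype.ext (htriv x y (hnz x) ⟨congrArg Subtype.val h1, congrArg Subtype.val h2⟩)
  · intro x y
    constructor
    · rintro ⟨hne, hxy⟩
      have h0 : (x : S) * y = 0 := by
        by_contra h0
        exact hne (Subtype.ext (htriv x y (hnz x) (hS.greenH_of_commute hxy h0)))
      exact ⟨hne,
        fun a b ha hb hla hrb => hS.mul_eq_zero_of_green ha hb hla.symm hrb.symm h0,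
        fun a b ha hb hla hrb => hS.mul_eq_zero_of_green ha hb hla.symm hrb.symm (hxy ▸ h0)⟩
    · rintro ⟨hne, h1, h2⟩
      exact ⟨hne, (h1 x y (hnz x) (hnz y) rfl rfl).trans (h2 y x (hnz y) (hnz x) rfl rfl).symm⟩

theorem egirth_of_greenH_nontrivial {x₀ y₀ : S} (hx₀ : x₀ ≠ 0) (hne : x₀ ≠ y₀)
    (h₀ : GreenH x₀ y₀) (hcycle : ¬ (commutingGraph S).IsAcyclic) :
    (commutingGraph S).egirth = 3 ∨ (commutingGraph S).egirth = 4 := by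
  by_cases hE : ∀ v w, (commutingGraph S).Adj v w → GreenH (v : S) w
  · obtain ⟨C, ⟨y, hy⟩, hC⟩ := exists_set_two_neighbors_of_not_isAcyclic hcycle
    obtain ⟨x, hx, z, -, hxz, hyx, hyz⟩ := hC y hy
    -- A second neighbour of `x` extends `x`, `y`, `z` to a three-edge path; `w = z` is allowed.
    obtain ⟨w, hwy, hxw⟩ : ∃ w, w ≠ y ∧ (commutingGraph S).Adj x w := by
      obtain ⟨a, -, b, -, hab, ha, hb⟩ := hC x hx
      by_cases h : a = y
      · exact ⟨b, fun h' => hab (h.trans h'.symm), hb⟩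
      · exact ⟨a, h, ha⟩
    exact hS.egirth_of_greenH_path hxw.symm hyx.symm hyz hwy hxz
      ((hE _ _ hyx).trans (hE _ _ hxw)) (hE _ _ hyx) (hE _ _ hyz)
  · push Not at hE
    obtain ⟨v, w, hvw, hn⟩ := hE
    have h0 : (v : S) * w = 0 := by
      by_contra h0
      exact hn (hS.greenH_of_commute hvw.2 h0)
    exact hS.egirth_of_mul_eq_zero hx₀ hne h₀ (ne_zero_of_notMem_center v.2)
      (ne_zero_of_notMem_center w.2) h0 (hvw.2 ▸ h0) hn

end IsZeroSimple

end ZeroSimple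

theorem mainTheorem12 {S : Type*} [SemigroupWithZero S] [Finite S]
    (hnc : ∃ x y : S, x * y ≠ y * x)
    (hS : IsCompletelyZeroSimple S)
    (hcycle : ¬ (commutingGraph S).IsAcyclic) :
    (commutingGraph S).egirth = 3 ∨ (commutingGraph S).egirth = 4 := by
  by_cases htriv : ∀ x y : S, x ≠ 0 → GreenH x y → x = y
  · exact hS.zeroSimple.egirth_of_greenH_trivial hnc htriv hcycle
  · push Not at htriv
    obtain ⟨x, y, hx, hxy, hne⟩ := htriv
    exact hS.zeroSimple.egirth_of_greenH_nontrivial hx hne hxy hcycle
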